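/- Let $(\Omega,\mathcal F,P)$ be a probability space. A real random variable $X$ is *subgaussian* if for some $c\ge 0$ one has $E e^{tX}\le e^{c^2t^2/2}$ for all $t\in\mathbb R$; $\tau(X)$ is the infimum of all such $c$. Put $\|X\|_\varphi=\inf\{c>0: E\varphi(|X|/c)\le 1\}$ with $\varphi(x)=e^{x^2}-1$. For a pseudo-metric $d$ on a set $T$, a process $(Z_t)_{t\in T}$ of subgaussian random variables has *$d$-subgaussian increments* if $E e^{\lambda(Z_v-Z_u)}\le e^{d(u,v)^2\lambda^2/2}$ for all $\lambda\in\mathbb R$, $u,v\in T$. The *decoupling coefficient* of a stationary centered Gaussian sequence $g=(g_k)_{k\ge1}$ with $E g_1^2>0$ is $$p(g)=\sum_{k\in\mathbb Z}\left|\frac{E(g_1g_{1+|k|})}{E(g_1^2)}\right|\in[1,\infty].$$ **Theorem 4.11.** Let $g=(g_k)_{k\ge1}$ and $g'=(g'_k)_{k\ge1}$ be stationary Gaussian sequences of $N(0,1)$ random variables on $(\Omega,\mathcal F,P)$ (no assumption is made on their joint law) with $p(g)<\infty$ and $p(g')<\infty$, and let $(a_k)_{k\ge1}$, $(b_k)_{k\ge1}$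 be real sequences. Put $R_0=0$ and $R_n=\sum_{k=1}^n(a_kg_k+b_kg'_k)$. Then $(R_n)_{n\ge0}$ has $\tilde d$-subgaussian increments for the pseudo-metric $\tilde d\ge 0$ on $\mathbb N$ given by $$\tilde d^{\,2}(i,j)=2\max(p(g),p(g'))\sum_{k=\min(i,j)+1}^{\max(i,j)}(a_k^2+b_k^2).$$ If in addition $\sum_{k\ge1}(a_k^2+b_k^2)<\infty$, then there is a subgaussian random variable $R_\infty$ such that $R_n\to R_\infty$ $P$-almost surely, $\tau(R_n-R_\infty)\to0$, $\|R_n-R_\infty\|_\varphi\to0$, and $$\tau(R_\infty)\le\Big(2\max(p(g),p(g'))\sum_{k=1}^\infty(a_k^2+b_k^2)\Big)^{1/2}.$$ -/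

import Mathlib

open MeasureTheory ProbabilityTheory Filter Topology
open scoped ENNReal NNReal

noncomputable section

/-- `X` is subgaussian: for some `c ≥ 0`, `E exp (t X) ≤ exp (c² t² / 2)` for all real `t`
(Mathlib's `HasSubgaussianMGF` takes the variance proxy `c²` and includes the finiteness of the
left-hand sides). -/
def IsSubgaussian {Ω : Type*} [MeasurableSpace Ω] (X : Ω → ℝ) (P : Measure Ω) : Prop :=
  ∃ c : ℝ≥0, HasSubgaussianMGF X (c ^ 2) P

/-- The subgaussian standard
`τ(X) = inf {c ≥ 0 : E exp (t X) ≤ exp (c² t² / 2) for all real t}`,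
with the value `∞` if `X` is not subgaussian. -/
def subgaussianStandard {Ω : Type*} [MeasurableSpace Ω] (X : Ω → ℝ) (P : Measure Ω) : ℝ≥0∞ :=
  ⨅ (c : ℝ≥0) (_ : HasSubgaussianMGF X (c ^ 2) P), (c : ℝ≥0∞)

/-- The Orlicz norm `‖X‖_ψ = inf {c > 0 : E ψ(|X| / c) ≤ 1}` of a Young function `ψ`,
with the value `∞` if `X` does not belong to the Orlicz space of `ψ`. -/
def orliczNorm (ψ : ℝ → ℝ) {Ω : Type*} [MeasurableSpace Ω] (X : Ω → ℝ) (P : Measure Ω) : ℝ≥0∞ :=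
  ⨅ (c : ℝ≥0) (_ : 0 < c ∧ ∫⁻ ω, ENNReal.ofReal (ψ (|X ω| / c)) ∂P ≤ 1), (c : ℝ≥0∞)

/-- The Young function `φ(x) = exp(x²) - 1`. -/
def youngPhi (x : ℝ) : ℝ := Real.exp (x ^ 2) - 1

/-- `d` is a pseudo-metric on `T`. -/
structure IsPseudoMetricFun {T : Type*} (d : T → T → ℝ) : Prop where
  nonneg : ∀ s t, 0 ≤ d s t
  self : ∀ t, d t t = 0
  symm : ∀ s t, d s t = d t s
  triangle : ∀ s t u, d s u ≤ d s t + d t u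

/-- A process `Z` of subgaussian random variables has `d`-subgaussian increments, where `d` is a
pseudo-metric on the index set: `E exp (t (Z_v - Z_u)) ≤ exp (d(u,v)² t² / 2)` for all real `t`
(the left-hand side being finite) and all `u, v`. -/
structure HasSubgaussianIncrements {Ω T : Type*} [MeasurableSpace Ω] (d : T → T → ℝ)
    (Z : T → Ω → ℝ) (P : Measure Ω) : Prop where
  isPseudoMetric : IsPseudoMetricFun d
  isSubgaussian : ∀ t, IsSubgaussian (Z t) P
  increments : ∀ u v, HasSubgaussianMGF (fun ω => Z v ω - Z u ω) (Real.toNNReal (d u v ^ 2)) P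

/-- (Strict) stationarity of a sequence: its law is invariant under all shifts. -/
def IsStationarySeq {Ω : Type*} [MeasurableSpace Ω] (g : ℕ → Ω → ℝ) (P : Measure Ω) : Prop :=
  ∀ m : ℕ, IdentDistrib (fun ω k => g (k + m) ω) (fun ω k => g k ω) P P

/-- A stationary Gaussian sequence of `N(0,1)` random variables. -/
structure IsStationaryStdGaussian {Ω : Type*} [MeasurableSpace Ω] (g : ℕ → Ω → ℝ)
    (P : Measure Ω) : Prop where
  isGaussianProcess : IsGaussianProcess g P
  isStationary : IsStationarySeq g P
  hasLaw : ∀ k, HasLaw (g k) (gaussianReal 0 1) P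

/-- The decoupling coefficient of a stationary centered Gaussian sequence: the sum, over all lags
`k ∈ ℤ`, of the absolute values of the autocorrelations. By stationarity the autocovariance at
lag `k` is the expectation of the product of the initial term and the term `|k|` places later. -/
def decouplingCoeff {Ω : Type*} [MeasurableSpace Ω] (g : ℕ → Ω → ℝ) (P : Measure Ω) : ℝ≥0∞ :=
  ∑' k : ℤ, ENNReal.ofReal |(∫ ω, g 0 ω * g k.natAbs ω ∂P) / (∫ ω, g 0 ω ^ 2 ∂P)|

/-- The partial sums of `∑ (a_k g_k + b_k g'_k)`. The sequences are indexed from `0`, the term of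
index `k` being the `(k+1)`-st one; `weightedSum a b g g' n` is the sum of the first `n` terms. -/
def weightedSum {Ω : Type*} (a b : ℕ → ℝ) (g g' : ℕ → Ω → ℝ) (n : ℕ) (ω : Ω) : ℝ :=
  ∑ k ∈ Finset.range n, (a k * g k ω + b k * g' k ω)

end

/-! For a single sequence, `∑ a k * g k` is a centered Gaussian variable, and Schur's test, with row
sums of the correlation matrix at most `p(g)`, bounds its variance by `p(g) ∑ a_k²`. Nothing is
known about the joint law of `g` and `g'`, so their sum only gets the proxy `(√x + √y)² ≤ 2 (x +
y)`: this is the factor 2.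

Almost sure convergence rests on fourth moments. Those of the increments are at most a constant
times the square of the additive interval function `∑ (a_k² + b_k²)`. Since the power 2 exceeds 1,
bisecting intervals gives a maximal inequality without logarithmic loss
(`lintegral_iSup_pow_four_le`), and the oscillation beyond `i` vanishes as the tail of the series
does.

By Fatou, `R_n - R_∞` is subgaussian with proxy proportional to that tail. This controls `τ` at
once, and the Orlicz norm through exponential square integrability. -/

/-! ### Subgaussian variables: limits, fourth moments, Orlicz norm. -/

section Subgaussian

variable {Ω : Type*} [MeasurableSpace Ω] {P : Measure Ω}

/-- Integrability and the bound merge into one inequality in `[0, ∞]`, the form suited to Fatou and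
Tonelli. -/
theorem hasSubgaussianMGF_iff_lintegral_le {X : Ω → ℝ} {c : ℝ≥0} (hX : AEMeasurable X P) :
    HasSubgaussianMGF X c P ↔
      ∀ t : ℝ, ∫⁻ ω, ENNReal.ofReal (Real.exp (t * X ω)) ∂P ≤
        ENNReal.ofReal (Real.exp (c * t ^ 2 / 2)) := by
  constructor
  · intro h t
    rw [← ofReal_integral_eq_lintegral_ofReal (h.integrable_exp_mul t)
      (ae_of_all _ fun _ => (Real.exp_pos _).le)]
    exact ENNReal.ofReal_le_ofReal (h.mgf_le t)
  · intro h
    have hint : ∀ t : ℝ, Integrable (fun ω => Real.exp (t * X ω)) P := fun t => by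
      refine ⟨(Real.measurable_exp.comp_aemeasurable (hX.const_mul t)).aestronglyMeasurable, ?_⟩
      rw [hasFiniteIntegral_iff_ofReal (ae_of_all _ fun _ => (Real.exp_pos _).le)]
      exact (h t).trans_lt ENNReal.ofReal_lt_top
    refine ⟨hint, fun t => ?_⟩
    have := h t
    rw [← ofReal_integral_eq_lintegral_ofReal (hint t)
      (ae_of_all _ fun _ => (Real.exp_pos _).le)] at this
    exact (ENNReal.ofReal_le_ofReal_iff (Real.exp_pos _).le).1 this

theorem ProbabilityTheory.HasSubgaussianMGF.mono {X : Ω → ℝ} {c c' : ℝ≥0}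
    (h : HasSubgaussianMGF X c P) (hc : c ≤ c') : HasSubgaussianMGF X c' P where
  integrable_exp_mul := h.integrable_exp_mul
  mgf_le t := (h.mgf_le t).trans <| by gcongr

/-- The variance proxy of an almost sure limit, by Fatou's lemma. -/
theorem ProbabilityTheory.HasSubgaussianMGF.of_tendsto {X : ℕ → Ω → ℝ} {Y : Ω → ℝ} {c : ℝ≥0}
    (hX : ∀ᶠ n in atTop, HasSubgaussianMGF (X n) c P)
    (h : ∀ᵐ ω ∂P, Tendsto (fun n => X n ω) atTop (𝓝 (Y ω))) :
    HasSubgaussianMGF Y c P := by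
  obtain ⟨N, hN⟩ := eventually_atTop.1 hX
  have hX' : ∀ n, HasSubgaussianMGF (X (n + N)) c P := fun n => hN _ (Nat.le_add_left _ _)
  have h' : ∀ᵐ ω ∂P, Tendsto (fun n => X (n + N) ω) atTop (𝓝 (Y ω)) := by
    filter_upwards [h] with ω hω using hω.comp (tendsto_add_atTop_nat N)
  have hY : AEMeasurable Y P :=
    aemeasurable_of_tendsto_metrizable_ae atTop (fun n => (hX' n).aemeasurable) h'
  rw [hasSubgaussianMGF_iff_lintegral_le hY]
  intro t
  calc ∫⁻ ω, ENNReal.ofReal (Real.exp (t * Y ω)) ∂P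
      = ∫⁻ ω, liminf (fun n => ENNReal.ofReal (Real.exp (t * X (n + N) ω))) atTop ∂P := by
        refine lintegral_congr_ae ?_
        filter_upwards [h'] with ω hω
        refine (Tendsto.liminf_eq ?_).symm
        exact ENNReal.tendsto_ofReal
          ((Real.continuous_exp.tendsto _).comp (hω.const_mul t))
    _ ≤ liminf (fun n => ∫⁻ ω, ENNReal.ofReal (Real.exp (t * X (n + N) ω)) ∂P) atTop :=
        lintegral_liminf_le' fun n => (Real.measurable_exp.comp_aemeasurable
          ((hX' n).aemeasurable.const_mul t)).ennreal_ofReal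
    _ ≤ ENNReal.ofReal (Real.exp (c * t ^ 2 / 2)) := by
        refine liminf_le_of_le (by isBoundedDefault) fun b hb => ?_
        obtain ⟨n, hn⟩ := hb.exists
        exact hn.trans ((hasSubgaussianMGF_iff_lintegral_le (hX' n).aemeasurable).1 (hX' n) t)

theorem pow_four_le_exp_add_exp_neg (x : ℝ) : x ^ 4 ≤ 24 * (Real.exp x + Real.exp (-x)) := by
  have h : |x| ^ 4 / (Nat.factorial 4 : ℝ) ≤ Real.exp |x| :=
    Real.pow_div_factorial_le_exp _ (abs_nonneg x) 4
  have h2 : Real.exp |x| ≤ Real.exp x + Real.exp (-x) := by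
    rcases abs_cases x with ⟨h, -⟩ | ⟨h, -⟩ <;> rw [h]
    · linarith [Real.exp_pos (-x)]
    · linarith [Real.exp_pos x]
  have h3 : |x| ^ 4 = x ^ 4 := by
    rw [← abs_pow, abs_of_nonneg (by positivity)]
  norm_num [Nat.factorial] at h
  rw [h3] at h
  linarith

theorem ProbabilityTheory.HasSubgaussianMGF.lintegral_pow_four_le {X : Ω → ℝ} {c : ℝ≥0}
    (h : HasSubgaussianMGF X c P) :
    ∫⁻ ω, ENNReal.ofReal (X ω ^ 4) ∂P ≤ ENNReal.ofReal (96 * (c : ℝ) ^ 2) := by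
  rcases eq_or_ne c 0 with rfl | hc
  · have : ∫⁻ ω, ENNReal.ofReal (X ω ^ 4) ∂P = ∫⁻ _, 0 ∂P := by
      refine lintegral_congr_ae ?_
      filter_upwards [h.ae_eq_zero_of_hasSubgaussianMGF_zero] with ω hω
      simp [hω]
    simp [this]
  have hc0 : (0 : ℝ) < c := by positivity
  -- At `t = ±c^(-1/2)` the moment generating function is at most `e^(1/2) ≤ 2`, whence `24 * (2 +
  -- 2) = 96`.
  set s : ℝ := (√(c : ℝ))⁻¹ with hs
  have hs2 : s ^ 2 = (c : ℝ)⁻¹ := by rw [hs, inv_pow, Real.sq_sqrt hc0.le]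
  have hs4 : s ^ 4 = ((c : ℝ) ^ 2)⁻¹ := by
    rw [show s ^ 4 = (s ^ 2) ^ 2 by ring, hs2, inv_pow]
  have hpt : ∀ ω, X ω ^ 4 ≤
      24 * (c : ℝ) ^ 2 * (Real.exp (s * X ω) + Real.exp (-s * X ω)) := by
    intro ω
    have h1 := pow_four_le_exp_add_exp_neg (s * X ω)
    rw [mul_pow, hs4] at h1
    have h2 := mul_le_mul_of_nonneg_left h1 (sq_nonneg (c : ℝ))
    rw [← mul_assoc, mul_inv_cancel₀ (by positivity), one_mul] at h2
    rw [neg_mul]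
    linarith
  have hi : ∀ t : ℝ, t ^ 2 = (c : ℝ)⁻¹ → ∫ ω, Real.exp (t * X ω) ∂P ≤ 2 := by
    intro t ht
    refine (h.mgf_le t).trans ?_
    rw [ht, mul_inv_cancel₀ hc0.ne']
    have h1 : Real.exp (1 / 2) ^ 2 = Real.exp 1 := by rw [← Real.exp_nat_mul]; norm_num
    nlinarith [Real.exp_one_lt_d9, Real.exp_pos (1 / 2)]
  have hint : Integrable (fun ω =>
      24 * (c : ℝ) ^ 2 * (Real.exp (s * X ω) + Real.exp (-s * X ω))) P :=
    ((h.integrable_exp_mul s).add (h.integrable_exp_mul (-s))).const_mul _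
  calc ∫⁻ ω, ENNReal.ofReal (X ω ^ 4) ∂P
      ≤ ∫⁻ ω, ENNReal.ofReal
          (24 * (c : ℝ) ^ 2 * (Real.exp (s * X ω) + Real.exp (-s * X ω))) ∂P :=
        lintegral_mono fun ω => ENNReal.ofReal_le_ofReal (hpt ω)
    _ = ENNReal.ofReal (∫ ω,
          24 * (c : ℝ) ^ 2 * (Real.exp (s * X ω) + Real.exp (-s * X ω)) ∂P) :=
        (ofReal_integral_eq_lintegral_ofReal hint (ae_of_all _ fun _ => by positivity)).symm
    _ ≤ ENNReal.ofReal (96 * (c : ℝ) ^ 2) := by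
        apply ENNReal.ofReal_le_ofReal
        rw [integral_const_mul, integral_add (h.integrable_exp_mul s) (h.integrable_exp_mul (-s))]
        have h1 := hi s hs2
        have h2 := hi (-s) (by rw [neg_sq, hs2])
        nlinarith [sq_nonneg (c : ℝ)]

/-- `E exp(α Y²) = (1 - 2α)^(-1/2)`; `α = 3/8` is the value giving exactly 2, the threshold `E φ ≤
1` of the Orlicz norm. -/
theorem lintegral_exp_mul_sq_gaussianReal :
    ∫⁻ y, ENNReal.ofReal (Real.exp (3 / 8 * y ^ 2)) ∂(gaussianReal 0 1) = 2 := by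
  rw [gaussianReal_of_var_ne_zero _ one_ne_zero,
    lintegral_withDensity_eq_lintegral_mul _ (measurable_gaussianPDF 0 1) (by fun_prop)]
  have hpt : ∀ y : ℝ, (gaussianPDF 0 1 * fun y => ENNReal.ofReal (Real.exp (3 / 8 * y ^ 2))) y =
      ENNReal.ofReal ((√(2 * Real.pi))⁻¹ * Real.exp (-(1 / 8) * y ^ 2)) := by
    intro y
    rw [Pi.mul_apply, gaussianPDF_def, ← ENNReal.ofReal_mul (gaussianPDFReal_nonneg _ _ _)]
    congr 1
    rw [gaussianPDFReal_def, mul_assoc, ← Real.exp_add]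
    simp only [NNReal.coe_one, mul_one]
    congr 2
    ring
  simp_rw [hpt]
  rw [← ofReal_integral_eq_lintegral_ofReal
    ((integrable_exp_neg_mul_sq (by norm_num : (0 : ℝ) < 1 / 8)).const_mul _)
    (ae_of_all _ fun _ => by positivity), integral_const_mul, integral_gaussian,
    ← Real.sqrt_inv, ← Real.sqrt_mul (by positivity)]
  rw [show (2 * Real.pi)⁻¹ * (Real.pi / (1 / 8)) = 2 ^ 2 by
    have := Real.pi_ne_zero
    field_simp; norm_num, Real.sqrt_sq (by norm_num)]
  norm_num

/-- Exponential square integrability of a subgaussian variable, by Gaussian linearization. -/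
theorem ProbabilityTheory.HasSubgaussianMGF.lintegral_exp_sq_le [SFinite P] {X : Ω → ℝ} {c : ℝ≥0}
    (h : HasSubgaussianMGF X c P) {ε : ℝ} (hε : 0 < ε) (hc : (c : ℝ) ≤ 3 / 8 * ε ^ 2) :
    ∫⁻ ω, ENNReal.ofReal (Real.exp ((|X ω| / ε) ^ 2)) ∂P ≤ 2 := by
  -- This is `exp(s²/2) = E exp(s Y)` for `Y` standard normal, with `s = √2 X / ε`.
  have hlin : ∀ ω, ENNReal.ofReal (Real.exp ((|X ω| / ε) ^ 2)) =
      ∫⁻ y, ENNReal.ofReal (Real.exp ((√2 / ε * X ω) * y)) ∂(gaussianReal 0 1) := by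
    intro ω
    rw [← ofReal_integral_eq_lintegral_ofReal (integrable_exp_mul_gaussianReal _)
      (ae_of_all _ fun _ => (Real.exp_pos _).le)]
    have := congrFun (mgf_fun_id_gaussianReal (μ := 0) (v := 1)) (√2 / ε * X ω)
    rw [mgf] at this
    rw [this]
    congr 2
    rw [div_pow, sq_abs, mul_pow, div_pow, Real.sq_sqrt zero_le_two]
    simp
    ring
  calc ∫⁻ ω, ENNReal.ofReal (Real.exp ((|X ω| / ε) ^ 2)) ∂P
      = ∫⁻ ω, ∫⁻ y, ENNReal.ofReal (Real.exp ((√2 / ε * X ω) * y)) ∂(gaussianReal 0 1) ∂P := by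
        simp_rw [hlin]
    _ = ∫⁻ y, ∫⁻ ω, ENNReal.ofReal (Real.exp ((√2 / ε * X ω) * y)) ∂P ∂(gaussianReal 0 1) := by
        refine lintegral_lintegral_swap ?_
        refine (Real.measurable_exp.comp_aemeasurable ?_).ennreal_ofReal
        exact (h.aemeasurable.comp_fst.const_mul _).mul measurable_snd.aemeasurable
    _ ≤ ∫⁻ y, ENNReal.ofReal (Real.exp (3 / 8 * y ^ 2)) ∂(gaussianReal 0 1) := by
        refine lintegral_mono fun y => ?_
        have h1 := (hasSubgaussianMGF_iff_lintegral_le h.aemeasurable).1 h (√2 / ε * y)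
        simp_rw [mul_right_comm] at h1 ⊢
        refine h1.trans (ENNReal.ofReal_le_ofReal (Real.exp_le_exp.2 ?_))
        have h2 : (√2 * y / ε) ^ 2 = 2 * y ^ 2 / ε ^ 2 := by
          rw [div_pow, mul_pow, Real.sq_sqrt zero_le_two]
        rw [show √2 / ε * y = √2 * y / ε by ring, h2]
        rw [show (c : ℝ) * (2 * y ^ 2 / ε ^ 2) / 2 = (c * y ^ 2) / ε ^ 2 by ring,
          div_le_iff₀ (by positivity)]
        nlinarith [mul_le_mul_of_nonneg_right hc (sq_nonneg y)]
    _ = 2 := lintegral_exp_mul_sq_gaussianReal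

theorem orliczNorm_youngPhi_le [IsProbabilityMeasure P] {X : Ω → ℝ} {c : ℝ≥0}
    (h : HasSubgaussianMGF X c P) {ε : ℝ≥0} (hε : 0 < ε) (hc : (c : ℝ) ≤ 3 / 8 * (ε : ℝ) ^ 2) :
    orliczNorm youngPhi X P ≤ ε := by
  refine iInf₂_le ε ⟨hε, ?_⟩
  have h1 := h.lintegral_exp_sq_le (NNReal.coe_pos.2 hε) hc
  have h2 : ∀ ω, ENNReal.ofReal (Real.exp ((|X ω| / ε) ^ 2)) =
      ENNReal.ofReal (youngPhi (|X ω| / ε)) + 1 := by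
    intro ω
    rw [← ENNReal.ofReal_one, ← ENNReal.ofReal_add _ zero_le_one]
    · simp [youngPhi]
    · have := Real.one_le_exp (sq_nonneg (|X ω| / ε))
      simp only [youngPhi]
      linarith
  simp_rw [h2] at h1
  rw [lintegral_add_right _ measurable_const, lintegral_one, measure_univ,
    ← one_add_one_eq_two] at h1
  exact (ENNReal.add_le_add_iff_right ENNReal.one_ne_top).1 h1

theorem subgaussianStandard_le {X : Ω → ℝ} {v : ℝ} (h : HasSubgaussianMGF X v.toNNReal P) :
    subgaussianStandard X P ≤ ENNReal.ofReal √v := by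
  refine iInf₂_le (√v).toNNReal ?_
  convert h
  rw [Real.sqrt, Real.toNNReal_coe, NNReal.sq_sqrt]

theorem isSubgaussian_of_hasSubgaussianMGF {X : Ω → ℝ} {c : ℝ≥0} (h : HasSubgaussianMGF X c P) :
    IsSubgaussian X P :=
  ⟨NNReal.sqrt c, by rwa [NNReal.sq_sqrt]⟩

end Subgaussian

/-! ### Maximal inequality and almost sure convergence. -/

section MaximalInequality

/-- Deleting a single index leaves two pieces of at most half the mass. Otherwise each prefix of at
most half is followed by another one, up to `h = j - 1`, whose empty suffix cannot exceed half. -/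
theorem exists_split_sum_Ico {u : ℕ → ℝ} (hu : ∀ k, 0 ≤ u k) {i j : ℕ} (hij : i < j) :
    ∃ h, i ≤ h ∧ h < j ∧
      ∑ k ∈ Finset.Ico i h, u k ≤ (∑ k ∈ Finset.Ico i j, u k) / 2 ∧
      ∑ k ∈ Finset.Ico (h + 1) j, u k ≤ (∑ k ∈ Finset.Ico i j, u k) / 2 := by
  by_contra! H
  have hw : 0 ≤ ∑ k ∈ Finset.Ico i j, u k := Finset.sum_nonneg fun k _ => hu k
  have key : ∀ h, i ≤ h → h < j →
      ∑ k ∈ Finset.Ico i h, u k ≤ (∑ k ∈ Finset.Ico i j, u k) / 2 := by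
    intro h hih
    induction h, hih using Nat.le_induction with
    | base => intro _; rw [Finset.Ico_self, Finset.sum_empty]; positivity
    | succ h hih ih =>
      intro hj
      have h1 := H h hih (by omega) (ih (by omega))
      have h2 := Finset.sum_Ico_consecutive u (show i ≤ h + 1 by omega) hj.le
      linarith
  have h1 := H (j - 1) (by omega) (by omega) (key _ (by omega) (by omega))
  rw [Nat.sub_add_cancel (by omega)] at h1
  simp only [Finset.Ico_self, Finset.sum_empty] at h1
  linarith

/-- The difference of the two sides is the first square plus twice the second. What matters below is
that the coefficient of `x ^ 4` is less than 3. -/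
theorem add_pow_four_le (x y : ℝ) : (x + y) ^ 4 ≤ 2 * x ^ 4 + 135 * y ^ 4 := by
  nlinarith [sq_nonneg (x ^ 2 - 2 * x * y - 6 * y ^ 2), sq_nonneg (y * (x - 7 * y))]

variable {Ω : Type*} [MeasurableSpace Ω] {P : Measure Ω}

/-- A maximal inequality of Billingsley type for fourth moments. -/
theorem lintegral_iSup_pow_four_le {S : ℕ → Ω → ℝ} (hS : ∀ n, AEMeasurable (S n) P)
    {u : ℕ → ℝ} (hu : ∀ k, 0 ≤ u k) {C : ℝ} (hC : 0 ≤ C)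
    (h : ∀ i j, i ≤ j → ∫⁻ ω, ENNReal.ofReal ((S j ω - S i ω) ^ 4) ∂P ≤
      ENNReal.ofReal (C * (∑ k ∈ Finset.Ico i j, u k) ^ 2)) {i j : ℕ} (hij : i ≤ j) :
    ∫⁻ ω, ⨆ k ∈ Finset.Icc i j, ENNReal.ofReal ((S k ω - S i ω) ^ 4) ∂P ≤
      ENNReal.ofReal (540 * C * (∑ k ∈ Finset.Ico i j, u k) ^ 2) := by
  have hmeas : ∀ i k, AEMeasurable (fun ω => ENNReal.ofReal ((S k ω - S i ω) ^ 4)) P :=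
    fun i k => (((hS k).sub (hS i)).pow_const 4).ennreal_ofReal
  have hsup : ∀ i j, AEMeasurable
      (fun ω => ⨆ k ∈ Finset.Icc i j, ENNReal.ofReal ((S k ω - S i ω) ^ 4)) P :=
    fun i j => AEMeasurable.biSup _ (Finset.Icc i j).countable_toSet fun k _ => hmeas i k
  suffices H : ∀ n i j, i ≤ j → j - i ≤ n →
      ∫⁻ ω, ⨆ k ∈ Finset.Icc i j, ENNReal.ofReal ((S k ω - S i ω) ^ 4) ∂P ≤
        ENNReal.ofReal (540 * C * (∑ k ∈ Finset.Ico i j, u k) ^ 2) from H _ i j hij le_rfl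
  intro n
  induction n with
  | zero =>
    intro i j hij hn
    obtain rfl : i = j := by omega
    simp
  | succ n ih =>
    intro i j hij hn
    rcases hij.eq_or_lt with rfl | hlt
    · simp
    obtain ⟨m, him, hmj, hw1, hw2⟩ := exists_split_sum_Ico hu hlt
    set w := ∑ k ∈ Finset.Ico i j, u k with hw
    have hw0 : 0 ≤ w := Finset.sum_nonneg fun k _ => hu k
    have hw3 : ∑ k ∈ Finset.Ico i (m + 1), u k ≤ w :=
      Finset.sum_le_sum_of_subset_of_nonneg (Finset.Ico_subset_Ico le_rfl hmj) fun k _ _ => hu k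
    have hpos : ∀ s : Finset ℕ, 0 ≤ ∑ k ∈ s, u k := fun s => Finset.sum_nonneg fun k _ => hu k
    -- Indices up to `m` are compared with `i` directly; later ones pass through `m + 1`, and the
    -- deleted index `m` enters only through the increment from `i` to `m + 1`.
    calc ∫⁻ ω, ⨆ k ∈ Finset.Icc i j, ENNReal.ofReal ((S k ω - S i ω) ^ 4) ∂P
        ≤ ∫⁻ ω, ((⨆ k ∈ Finset.Icc i m, ENNReal.ofReal ((S k ω - S i ω) ^ 4)) +
            (2 * (⨆ k ∈ Finset.Icc (m + 1) j, ENNReal.ofReal ((S k ω - S (m + 1) ω) ^ 4)) +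
              135 * ENNReal.ofReal ((S (m + 1) ω - S i ω) ^ 4))) ∂P := by
          refine lintegral_mono fun ω => iSup₂_le fun k hk => ?_
          rw [Finset.mem_Icc] at hk
          rcases Nat.lt_or_ge m k with hmk | hkm
          · refine le_trans ?_ le_add_self
            have h1 : ENNReal.ofReal ((S k ω - S i ω) ^ 4) ≤
                2 * ENNReal.ofReal ((S k ω - S (m + 1) ω) ^ 4) +
                  135 * ENNReal.ofReal ((S (m + 1) ω - S i ω) ^ 4) := by
              rw [show (2 : ℝ≥0∞) = ENNReal.ofReal 2 by simp,
                show (135 : ℝ≥0∞) = ENNReal.ofReal 135 by simp,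
                ← ENNReal.ofReal_mul (by norm_num), ← ENNReal.ofReal_mul (by norm_num),
                ← ENNReal.ofReal_add (by positivity) (by positivity)]
              apply ENNReal.ofReal_le_ofReal
              have := add_pow_four_le (S k ω - S (m + 1) ω) (S (m + 1) ω - S i ω)
              rwa [sub_add_sub_cancel] at this
            refine h1.trans ?_
            gcongr
            exact le_iSup₂_of_le k (Finset.mem_Icc.2 ⟨hmk, hk.2⟩) le_rfl
          · refine le_trans ?_ le_self_add
            exact le_iSup₂_of_le k (Finset.mem_Icc.2 ⟨hk.1, hkm⟩) le_rfl
      _ = (∫⁻ ω, ⨆ k ∈ Finset.Icc i m, ENNReal.ofReal ((S k ω - S i ω) ^ 4) ∂P) +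
            (2 * (∫⁻ ω, ⨆ k ∈ Finset.Icc (m + 1) j,
                ENNReal.ofReal ((S k ω - S (m + 1) ω) ^ 4) ∂P) +
              135 * ∫⁻ ω, ENNReal.ofReal ((S (m + 1) ω - S i ω) ^ 4) ∂P) := by
          rw [lintegral_add_left' (hsup _ _), lintegral_add_left' ((hsup _ _).const_mul _),
            lintegral_const_mul'' _ (hsup _ _), lintegral_const_mul'' _ (hmeas _ _)]
      _ ≤ ENNReal.ofReal (540 * C * (w / 2) ^ 2) +
            (2 * ENNReal.ofReal (540 * C * (w / 2) ^ 2) + 135 * ENNReal.ofReal (C * w ^ 2)) := by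
          gcongr
          · refine (ih i m him (by omega)).trans (ENNReal.ofReal_le_ofReal ?_)
            have := hpos (Finset.Ico i m)
            gcongr
          · refine (ih (m + 1) j hmj (by omega)).trans (ENNReal.ofReal_le_ofReal ?_)
            have := hpos (Finset.Ico (m + 1) j)
            gcongr
          · refine (h i (m + 1) (by omega)).trans (ENNReal.ofReal_le_ofReal ?_)
            have := hpos (Finset.Ico i (m + 1))
            gcongr
      -- The constant solves `K/4 + 2K/4 + 135 = K`.
      _ = ENNReal.ofReal (540 * C * w ^ 2) := by
          rw [show (2 : ℝ≥0∞) = ENNReal.ofReal 2 by simp,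
            show (135 : ℝ≥0∞) = ENNReal.ofReal 135 by simp,
            ← ENNReal.ofReal_mul (by norm_num), ← ENNReal.ofReal_mul (by norm_num),
            ← ENNReal.ofReal_add (by positivity) (by positivity),
            ← ENNReal.ofReal_add (by positivity) (by positivity)]
          congr 1
          ring

/-- Almost sure convergence from a fourth-moment bound by the square of an additive function of
intervals. -/
theorem ae_exists_tendsto_of_lintegral_pow_four_le {S : ℕ → Ω → ℝ}
    (hS : ∀ n, AEMeasurable (S n) P) {u : ℕ → ℝ} (hu : ∀ k, 0 ≤ u k) (hsum : Summable u)
    {C : ℝ} (hC : 0 ≤ C)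
    (h : ∀ i j, i ≤ j → ∫⁻ ω, ENNReal.ofReal ((S j ω - S i ω) ^ 4) ∂P ≤
      ENNReal.ofReal (C * (∑ k ∈ Finset.Ico i j, u k) ^ 2)) :
    ∀ᵐ ω ∂P, ∃ l, Tendsto (fun n => S n ω) atTop (𝓝 l) := by
  have hmeas : ∀ i k, AEMeasurable (fun ω => ENNReal.ofReal ((S k ω - S i ω) ^ 4)) P :=
    fun i k => (((hS k).sub (hS i)).pow_const 4).ennreal_ofReal
  have hsup : ∀ i j, AEMeasurable
      (fun ω => ⨆ k ∈ Finset.Icc i j, ENNReal.ofReal ((S k ω - S i ω) ^ 4)) P :=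
    fun i j => AEMeasurable.biSup _ (Finset.Icc i j).countable_toSet fun k _ => hmeas i k
  -- Fourth power of the largest deviation from `S i` after time `i`; the supremum over `j` is
  -- monotone, so the maximal inequality passes to it.
  let M : ℕ → Ω → ℝ≥0∞ := fun i ω =>
    ⨆ j, ⨆ k ∈ Finset.Icc i j, ENNReal.ofReal ((S k ω - S i ω) ^ 4)
  have hM : ∀ i, AEMeasurable (M i) P := fun i => AEMeasurable.iSup fun j => hsup i j
  have hMle : ∀ i, ∫⁻ ω, M i ω ∂P ≤
      ENNReal.ofReal (540 * C * (∑' k, u k - ∑ k ∈ Finset.range i, u k) ^ 2) := by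
    intro i
    rw [lintegral_iSup' (fun j => hsup i j)]
    · refine iSup_le fun j => ?_
      rcases le_or_gt i j with hij | hji
      · refine (lintegral_iSup_pow_four_le hS hu hC h hij).trans (ENNReal.ofReal_le_ofReal ?_)
        have h0 : 0 ≤ ∑ k ∈ Finset.Ico i j, u k := Finset.sum_nonneg fun k _ => hu k
        have h1 : ∑ k ∈ Finset.Ico i j, u k ≤ ∑' k, u k - ∑ k ∈ Finset.range i, u k := by
          rw [Finset.sum_Ico_eq_sub u hij]
          linarith [hsum.sum_le_tsum (Finset.range j) fun k _ => hu k]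
        gcongr
      · simp [Finset.Icc_eq_empty_of_lt hji]
    · refine ae_of_all _ fun ω j j' hjj' => ?_
      exact biSup_mono fun k hk => Finset.Icc_subset_Icc le_rfl hjj' hk
  have hlim : Tendsto (fun i => ENNReal.ofReal
      (540 * C * (∑' k, u k - ∑ k ∈ Finset.range i, u k) ^ 2)) atTop (𝓝 0) := by
    have h1 := ((hsum.hasSum.tendsto_sum_nat.const_sub (∑' k, u k)).pow 2).const_mul (540 * C)
    have h2 := ENNReal.tendsto_ofReal h1
    simpa using h2
  have hzero : ∫⁻ ω, ⨅ i, M i ω ∂P = 0 := by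
    refine le_antisymm (ge_of_tendsto' hlim fun i => ?_) zero_le
    exact (lintegral_mono fun ω => iInf_le _ i).trans (hMle i)
  rw [lintegral_eq_zero_iff' (AEMeasurable.iInf hM)] at hzero
  filter_upwards [hzero] with ω hω
  -- A small `M i ω` keeps every later term close to `S i ω`, so a zero infimum over `i` is the
  -- Cauchy property.
  refine cauchySeq_tendsto_of_complete (Metric.cauchySeq_iff'.2 fun ε hε => ?_)
  have h1 : ⨅ i, M i ω < ENNReal.ofReal (ε ^ 4) := by
    rw [hω]
    simpa using by positivity
  obtain ⟨i, hi⟩ := iInf_lt_iff.1 h1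
  refine ⟨i, fun k hk => ?_⟩
  have h2 : ENNReal.ofReal ((S k ω - S i ω) ^ 4) < ENNReal.ofReal (ε ^ 4) := by
    refine lt_of_le_of_lt ?_ hi
    exact le_iSup_of_le k (le_iSup₂_of_le k (Finset.mem_Icc.2 ⟨hk, le_rfl⟩) le_rfl)
  rw [ENNReal.ofReal_lt_ofReal_iff (by positivity)] at h2
  rw [Real.dist_eq]
  refine lt_of_pow_lt_pow_left₀ 4 hε.le ?_
  rwa [← abs_pow, abs_of_nonneg (by positivity)]

end MaximalInequality

/-! ### Gaussian sums and the decoupling coefficient. -/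

section StationaryGaussian

variable {Ω : Type*} [MeasurableSpace Ω] {P : Measure Ω} {g : ℕ → Ω → ℝ}

theorem IsStationaryStdGaussian.integral_eq_zero (hg : IsStationaryStdGaussian g P) (k : ℕ) :
    ∫ ω, g k ω ∂P = 0 := by
  rw [(hg.hasLaw k).integral_eq, integral_id_gaussianReal]

theorem IsStationaryStdGaussian.variance_eq_one (hg : IsStationaryStdGaussian g P) (k : ℕ) :
    Var[g k; P] = 1 := by
  rw [(hg.hasLaw k).variance_eq, variance_id_gaussianReal, NNReal.coe_one]

theorem IsStationaryStdGaussian.memLp_two (hg : IsStationaryStdGaussian g P) (k : ℕ) :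
    MemLp (g k) 2 P :=
  (hg.isGaussianProcess.hasGaussianLaw_eval k).memLp_two

theorem IsStationarySeq.integral_mul_eq (hg : IsStationarySeq g P) (i k : ℕ) :
    ∫ ω, g i ω * g (k + i) ω ∂P = ∫ ω, g 0 ω * g k ω ∂P := by
  have h := ((hg i).comp (u := fun x : ℕ → ℝ => x 0 * x k) (by fun_prop)).integral_eq
  simpa [Function.comp_def] using h

theorem IsStationaryStdGaussian.covariance_eq [IsProbabilityMeasure P]
    (hg : IsStationaryStdGaussian g P) (i j : ℕ) :
    cov[g i, g j; P] = ∫ ω, g 0 ω * g ((j : ℤ) - i).natAbs ω ∂P := by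
  wlog hij : i ≤ j generalizing i j
  · rw [covariance_comm, this j i (by omega), ← Int.natAbs_neg, neg_sub]
  rw [covariance_eq_sub (hg.memLp_two i) (hg.memLp_two j), hg.integral_eq_zero, zero_mul, sub_zero]
  obtain ⟨k, rfl⟩ := Nat.exists_eq_add_of_le' hij
  rw [show (((k + i : ℕ) : ℤ) - i).natAbs = k by omega]
  exact hg.isStationary.integral_mul_eq i k

theorem IsStationaryStdGaussian.decouplingCoeff_eq [IsProbabilityMeasure P]
    (hg : IsStationaryStdGaussian g P) :
    decouplingCoeff g P = ∑' k : ℤ, ENNReal.ofReal |∫ ω, g 0 ω * g k.natAbs ω ∂P| := by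
  have h1 : ∫ ω, g 0 ω ^ 2 ∂P = 1 := by
    rw [← hg.variance_eq_one 0,
      variance_of_integral_eq_zero (hg.memLp_two 0).aemeasurable (hg.integral_eq_zero 0)]
  simp_rw [decouplingCoeff, h1, div_one]

/-- Row sums for Schur's test: `j ↦ j - i` injects the row into the lags of both signs. -/
theorem IsStationaryStdGaussian.sum_abs_covariance_le [IsProbabilityMeasure P]
    (hg : IsStationaryStdGaussian g P) (hp : decouplingCoeff g P < ∞) (s : Finset ℕ) (i : ℕ) :
    ∑ j ∈ s, |cov[g i, g j; P]| ≤ (decouplingCoeff g P).toReal := by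
  rw [← ENNReal.ofReal_le_iff_le_toReal hp.ne, ENNReal.ofReal_sum_of_nonneg fun _ _ => abs_nonneg _,
    hg.decouplingCoeff_eq]
  have hinj : Function.Injective fun j : ℕ => (j : ℤ) - i := fun x y h => by
    simpa using h
  calc ∑ j ∈ s, ENNReal.ofReal |cov[g i, g j; P]|
      = ∑ k ∈ s.map ⟨_, hinj⟩, ENNReal.ofReal |∫ ω, g 0 ω * g k.natAbs ω ∂P| := by
        rw [Finset.sum_map]
        exact Finset.sum_congr rfl fun j _ => by rw [hg.covariance_eq]; rfl
    _ ≤ _ := ENNReal.sum_le_tsum _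

/-- Schur's test: `a_i a_j ≤ (a_i² + a_j²) / 2` and the symmetry of the covariance reduce the
quadratic form to row sums. -/
theorem IsStationaryStdGaussian.variance_sum_le [IsProbabilityMeasure P]
    (hg : IsStationaryStdGaussian g P) (hp : decouplingCoeff g P < ∞) (a : ℕ → ℝ)
    (s : Finset ℕ) :
    Var[fun ω => ∑ k ∈ s, a k * g k ω; P] ≤
      (decouplingCoeff g P).toReal * ∑ k ∈ s, a k ^ 2 := by
  rw [variance_fun_sum' fun k _ => (hg.memLp_two k).const_mul (a k)]
  simp_rw [covariance_const_mul_left, covariance_const_mul_right]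
  have hpt : ∀ i j, a i * (a j * cov[g i, g j; P]) ≤
      a i ^ 2 / 2 * |cov[g i, g j; P]| + a j ^ 2 / 2 * |cov[g j, g i; P]| := by
    intro i j
    rw [covariance_comm (g j) (g i), ← add_mul, ← mul_assoc]
    calc a i * a j * cov[g i, g j; P] ≤ |a i * a j| * |cov[g i, g j; P]| := by
          rw [← abs_mul]; exact le_abs_self _
      _ ≤ _ := by
          gcongr
          rw [abs_le]
          constructor <;> nlinarith [sq_nonneg (a i + a j), sq_nonneg (a i - a j)]
  calc ∑ i ∈ s, ∑ j ∈ s, a i * (a j * cov[g i, g j; P])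
      ≤ ∑ i ∈ s, ∑ j ∈ s,
          (a i ^ 2 / 2 * |cov[g i, g j; P]| + a j ^ 2 / 2 * |cov[g j, g i; P]|) :=
        Finset.sum_le_sum fun i _ => Finset.sum_le_sum fun j _ => hpt i j
    _ = ∑ i ∈ s, a i ^ 2 * ∑ j ∈ s, |cov[g i, g j; P]| := by
        simp_rw [Finset.sum_add_distrib]
        rw [Finset.sum_comm (f := fun i j => a j ^ 2 / 2 * |cov[g j, g i; P]|),
          ← Finset.sum_add_distrib]
        refine Finset.sum_congr rfl fun i _ => ?_
        rw [← Finset.mul_sum, ← add_mul, add_halves]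
    _ ≤ ∑ i ∈ s, a i ^ 2 * (decouplingCoeff g P).toReal :=
        Finset.sum_le_sum fun i _ =>
          mul_le_mul_of_nonneg_left (hg.sum_abs_covariance_le hp s i) (sq_nonneg _)
    _ = _ := by rw [← Finset.sum_mul, mul_comm]

theorem IsStationaryStdGaussian.hasSubgaussianMGF_sum [IsProbabilityMeasure P]
    (hg : IsStationaryStdGaussian g P) (hp : decouplingCoeff g P < ∞) (a : ℕ → ℝ)
    (s : Finset ℕ) :
    HasSubgaussianMGF (fun ω => ∑ k ∈ s, a k * g k ω)
      ((decouplingCoeff g P).toReal * ∑ k ∈ s, a k ^ 2).toNNReal P := by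
  have hlaw : HasGaussianLaw (fun ω => ∑ k ∈ s, a k * g k ω) P :=
    (hg.isGaussianProcess.smul a).hasGaussianLaw_fun_sum
  have hmean : ∫ ω, ∑ k ∈ s, a k * g k ω ∂P = 0 := by
    rw [integral_finsetSum _ fun k _ => ((hg.memLp_two k).integrable one_le_two).const_mul (a k)]
    simp [integral_const_mul, hg.integral_eq_zero]
  have hmap := hlaw.map_eq_gaussianReal
  rw [hmean] at hmap
  constructor
  · intro t
    have h := integrable_exp_mul_gaussianReal (μ := 0)
      (v := Var[fun ω => ∑ k ∈ s, a k * g k ω; P].toNNReal) t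
    rw [← hmap] at h
    exact h.comp_aemeasurable hlaw.aemeasurable
  · intro t
    rw [mgf_gaussianReal hmap, zero_mul, zero_add, Real.exp_le_exp]
    gcongr
    exact hg.variance_sum_le hp a s

variable {g' : ℕ → Ω → ℝ}

theorem hasSubgaussianMGF_sum_add [IsProbabilityMeasure P]
    (hg : IsStationaryStdGaussian g P) (hg' : IsStationaryStdGaussian g' P)
    (hp : decouplingCoeff g P < ∞) (hp' : decouplingCoeff g' P < ∞) (a b : ℕ → ℝ)
    (s : Finset ℕ) :
    HasSubgaussianMGF (fun ω => ∑ k ∈ s, (a k * g k ω + b k * g' k ω))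
      (2 * (max (decouplingCoeff g P) (decouplingCoeff g' P)).toReal *
        ∑ k ∈ s, (a k ^ 2 + b k ^ 2)).toNNReal P := by
  simp_rw [Finset.sum_add_distrib]
  refine ((hg.hasSubgaussianMGF_sum hp a s).add (hg'.hasSubgaussianMGF_sum hp' b s)).mono ?_
  have hmax : max (decouplingCoeff g P) (decouplingCoeff g' P) ≠ ∞ := (max_lt hp hp').ne
  have h1 : (decouplingCoeff g P).toReal ≤
      (max (decouplingCoeff g P) (decouplingCoeff g' P)).toReal :=
    ENNReal.toReal_mono hmax (le_max_left _ _)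
  have h2 : (decouplingCoeff g' P).toReal ≤
      (max (decouplingCoeff g P) (decouplingCoeff g' P)).toReal :=
    ENNReal.toReal_mono hmax (le_max_right _ _)
  have hA : 0 ≤ ∑ k ∈ s, a k ^ 2 := Finset.sum_nonneg fun k _ => sq_nonneg _
  have hB : 0 ≤ ∑ k ∈ s, b k ^ 2 := Finset.sum_nonneg fun k _ => sq_nonneg _
  have hx : 0 ≤ (decouplingCoeff g P).toReal * ∑ k ∈ s, a k ^ 2 := by positivity
  have hy : 0 ≤ (decouplingCoeff g' P).toReal * ∑ k ∈ s, b k ^ 2 := by positivity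
  rw [← NNReal.coe_le_coe, Real.coe_toNNReal _ (by positivity)]
  push_cast
  rw [Real.coe_toNNReal _ hx, Real.coe_toNNReal _ hy]
  have h3 := mul_le_mul_of_nonneg_right h1 hA
  have h4 := mul_le_mul_of_nonneg_right h2 hB
  -- `(√x + √y)² ≤ 2 (x + y)`, that is, `(√x - √y)² ≥ 0`.
  nlinarith [sq_nonneg (√((decouplingCoeff g P).toReal * ∑ k ∈ s, a k ^ 2) -
    √((decouplingCoeff g' P).toReal * ∑ k ∈ s, b k ^ 2)), Real.sq_sqrt hx, Real.sq_sqrt hy]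

end StationaryGaussian

/-! ### Increments and limit of the weighted sums. -/

section WeightedSum

/-- The interval from `i` to `l` is covered by those from `i` to `j` and from `j` to `l`; then `√(x
+ y) ≤ √x + √y`. -/
theorem isPseudoMetricFun_sqrt_sum_Ico {u : ℕ → ℝ} (hu : ∀ k, 0 ≤ u k) {C : ℝ} (hC : 0 ≤ C) :
    IsPseudoMetricFun fun i j : ℕ => √(C * ∑ k ∈ Finset.Ico (min i j) (max i j), u k) where
  nonneg _ _ := Real.sqrt_nonneg _
  self _ := by simp
  symm i j := by rw [min_comm, max_comm]
  triangle i j l := by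
    have hpos : ∀ s : Finset ℕ, 0 ≤ ∑ k ∈ s, u k := fun s => Finset.sum_nonneg fun k _ => hu k
    have hsub : Finset.Ico (min i l) (max i l) ⊆
        Finset.Ico (min i j) (max i j) ∪ Finset.Ico (min j l) (max j l) := by
      intro k hk
      simp only [Finset.mem_union, Finset.mem_Ico] at hk ⊢
      omega
    have h1 : ∑ k ∈ Finset.Ico (min i l) (max i l), u k ≤
        ∑ k ∈ Finset.Ico (min i j) (max i j), u k + ∑ k ∈ Finset.Ico (min j l) (max j l), u k := by
      refine (Finset.sum_le_sum_of_subset_of_nonneg hsub fun k _ _ => hu k).trans ?_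
      rw [← Finset.sum_union_inter]
      exact le_add_of_nonneg_right (hpos _)
    refine (Real.sqrt_le_sqrt (mul_le_mul_of_nonneg_left h1 hC)).trans ?_
    rw [mul_add]
    have h2 := mul_nonneg hC (hpos (Finset.Ico (min i j) (max i j)))
    have h3 := mul_nonneg hC (hpos (Finset.Ico (min j l) (max j l)))
    refine Real.sqrt_le_iff.2 ⟨by positivity, ?_⟩
    rw [add_sq, Real.sq_sqrt h2, Real.sq_sqrt h3]
    linarith [mul_nonneg (Real.sqrt_nonneg (C * ∑ k ∈ Finset.Ico (min i j) (max i j), u k))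
      (Real.sqrt_nonneg (C * ∑ k ∈ Finset.Ico (min j l) (max j l), u k))]

theorem weightedSum_sub_weightedSum {Ω : Type*} (a b : ℕ → ℝ) (g g' : ℕ → Ω → ℝ) {i j : ℕ}
    (hij : i ≤ j) (ω : Ω) :
    weightedSum a b g g' j ω - weightedSum a b g g' i ω =
      ∑ k ∈ Finset.Ico i j, (a k * g k ω + b k * g' k ω) :=
  (Finset.sum_Ico_eq_sub _ hij).symm

variable {Ω : Type*} [MeasurableSpace Ω] {P : Measure Ω} [IsProbabilityMeasure P]
  {g g' : ℕ → Ω → ℝ}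

theorem hasSubgaussianMGF_weightedSum_sub
    (hg : IsStationaryStdGaussian g P) (hg' : IsStationaryStdGaussian g' P)
    (hp : decouplingCoeff g P < ∞) (hp' : decouplingCoeff g' P < ∞) (a b : ℕ → ℝ) (i j : ℕ) :
    HasSubgaussianMGF (fun ω => weightedSum a b g g' j ω - weightedSum a b g g' i ω)
      (2 * (max (decouplingCoeff g P) (decouplingCoeff g' P)).toReal *
        ∑ k ∈ Finset.Ico (min i j) (max i j), (a k ^ 2 + b k ^ 2)).toNNReal P := by
  rcases le_total i j with hij | hji
  · simp_rw [weightedSum_sub_weightedSum a b g g' hij, min_eq_left hij, max_eq_right hij]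
    exact hasSubgaussianMGF_sum_add hg hg' hp hp' a b _
  · simp_rw [min_eq_right hji, max_eq_left hji]
    refine (hasSubgaussianMGF_sum_add hg hg' hp hp' a b _).neg.congr (ae_of_all _ fun ω => ?_)
    rw [Pi.neg_apply, ← weightedSum_sub_weightedSum a b g g' hji, neg_sub]

theorem hasSubgaussianIncrements_weightedSum
    (hg : IsStationaryStdGaussian g P) (hg' : IsStationaryStdGaussian g' P)
    (hp : decouplingCoeff g P < ∞) (hp' : decouplingCoeff g' P < ∞) (a b : ℕ → ℝ) :
    HasSubgaussianIncrements
      (fun i j : ℕ => √(2 * (max (decouplingCoeff g P) (decouplingCoeff g' P)).toReal *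
        ∑ k ∈ Finset.Ico (min i j) (max i j), (a k ^ 2 + b k ^ 2)))
      (weightedSum a b g g') P where
  isPseudoMetric := isPseudoMetricFun_sqrt_sum_Ico (fun _ => by positivity) (by positivity)
  isSubgaussian n :=
    isSubgaussian_of_hasSubgaussianMGF (hasSubgaussianMGF_sum_add hg hg' hp hp' a b _)
  increments i j := by
    rw [Real.sq_sqrt (mul_nonneg (by positivity) (Finset.sum_nonneg fun _ _ => by positivity))]
    exact hasSubgaussianMGF_weightedSum_sub hg hg' hp hp' a b i j

theorem ae_exists_tendsto_weightedSum
    (hg : IsStationaryStdGaussian g P) (hg' : IsStationaryStdGaussian g' P)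
    (hp : decouplingCoeff g P < ∞) (hp' : decouplingCoeff g' P < ∞) {a b : ℕ → ℝ}
    (hsum : Summable fun k => a k ^ 2 + b k ^ 2) :
    ∀ᵐ ω ∂P, ∃ l, Tendsto (fun n => weightedSum a b g g' n ω) atTop (𝓝 l) := by
  set C := 2 * (max (decouplingCoeff g P) (decouplingCoeff g' P)).toReal
  have hu : ∀ k, 0 ≤ a k ^ 2 + b k ^ 2 := fun k => by positivity
  refine ae_exists_tendsto_of_lintegral_pow_four_le
    (fun n => (hasSubgaussianMGF_sum_add hg hg' hp hp' a b _).aemeasurable) hu hsum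
    (C := 96 * C ^ 2) (by positivity) fun i j hij => ?_
  have h := (hasSubgaussianMGF_weightedSum_sub hg hg' hp hp' a b i j).lintegral_pow_four_le
  rw [min_eq_left hij, max_eq_right hij, Real.coe_toNNReal _
    (mul_nonneg (by positivity) (Finset.sum_nonneg fun k _ => hu k)), mul_pow, ← mul_assoc] at h
  exact h

/-- For fixed `n`, the differences `R_n - R_m` with `m ≥ n` share the tail proxy, which survives `m
→ ∞`. -/
theorem hasSubgaussianMGF_weightedSum_sub_limit
    (hg : IsStationaryStdGaussian g P) (hg' : IsStationaryStdGaussian g' P)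
    (hp : decouplingCoeff g P < ∞) (hp' : decouplingCoeff g' P < ∞) {a b : ℕ → ℝ}
    (hsum : Summable fun k => a k ^ 2 + b k ^ 2) {R : Ω → ℝ}
    (hR : ∀ᵐ ω ∂P, Tendsto (fun n => weightedSum a b g g' n ω) atTop (𝓝 (R ω))) (n : ℕ) :
    HasSubgaussianMGF (fun ω => weightedSum a b g g' n ω - R ω)
      (2 * (max (decouplingCoeff g P) (decouplingCoeff g' P)).toReal *
        (∑' k, (a k ^ 2 + b k ^ 2) - ∑ k ∈ Finset.range n, (a k ^ 2 + b k ^ 2))).toNNReal P := by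
  refine HasSubgaussianMGF.of_tendsto
    (X := fun m ω => weightedSum a b g g' n ω - weightedSum a b g g' m ω) ?_ ?_
  · filter_upwards [eventually_ge_atTop n] with m hm
    refine (hasSubgaussianMGF_weightedSum_sub hg hg' hp hp' a b m n).mono ?_
    rw [min_eq_right hm, max_eq_left hm, Finset.sum_Ico_eq_sub _ hm]
    gcongr
    exact hsum.sum_le_tsum _ fun k _ => by positivity
  · filter_upwards [hR] with ω hω using hω.const_sub _

end WeightedSum

theorem theorem4p11 {Ω : Type*} [MeasurableSpace Ω] (P : Measure Ω) [IsProbabilityMeasure P]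
    (g g' : ℕ → Ω → ℝ)
    (hg : IsStationaryStdGaussian g P) (hg' : IsStationaryStdGaussian g' P)
    (hp : decouplingCoeff g P < ∞) (hp' : decouplingCoeff g' P < ∞)
    (a b : ℕ → ℝ) :
    HasSubgaussianIncrements
      (fun i j : ℕ => √(2 * (max (decouplingCoeff g P) (decouplingCoeff g' P)).toReal *
        ∑ k ∈ Finset.Ico (min i j) (max i j), (a k ^ 2 + b k ^ 2)))
      (weightedSum a b g g') P ∧
    (Summable (fun k => a k ^ 2 + b k ^ 2) →
      ∃ R : Ω → ℝ, Measurable R ∧ IsSubgaussian R P ∧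
        (∀ᵐ ω ∂P, Tendsto (fun n => weightedSum a b g g' n ω) atTop (𝓝 (R ω))) ∧
        Tendsto (fun n => subgaussianStandard (fun ω => weightedSum a b g g' n ω - R ω) P)
          atTop (𝓝 0) ∧
        Tendsto (fun n => orliczNorm youngPhi (fun ω => weightedSum a b g g' n ω - R ω) P)
          atTop (𝓝 0) ∧
        subgaussianStandard R P ≤
          ENNReal.ofReal √(2 * (max (decouplingCoeff g P) (decouplingCoeff g' P)).toReal *
            ∑' k, (a k ^ 2 + b k ^ 2))) := by
  refine ⟨hasSubgaussianIncrements_weightedSum hg hg' hp hp' a b, fun hsum => ?_⟩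
  obtain ⟨R, hRm, hR⟩ := measurable_limit_of_tendsto_metrizable_ae
    (fun n => (hasSubgaussianMGF_sum_add hg hg' hp hp' a b (Finset.range n)).aemeasurable)
    (ae_exists_tendsto_weightedSum hg hg' hp hp' hsum)
  have hsub := hasSubgaussianMGF_weightedSum_sub_limit hg hg' hp hp' hsum hR
  have hlim : Tendsto (fun n => 2 * (max (decouplingCoeff g P) (decouplingCoeff g' P)).toReal *
      (∑' k, (a k ^ 2 + b k ^ 2) - ∑ k ∈ Finset.range n, (a k ^ 2 + b k ^ 2))) atTop (𝓝 0) := by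
    have h := (hsum.hasSum.tendsto_sum_nat.const_sub (∑' k, (a k ^ 2 + b k ^ 2))).const_mul
      (2 * (max (decouplingCoeff g P) (decouplingCoeff g' P)).toReal)
    rwa [sub_self, mul_zero] at h
  have hRsub : HasSubgaussianMGF R
      (2 * (max (decouplingCoeff g P) (decouplingCoeff g' P)).toReal *
        ∑' k, (a k ^ 2 + b k ^ 2)).toNNReal P := by
    -- As `R_0 = 0`, the limit is `-(R_0 - R)` and the tail is the whole series.
    have h := (hsub 0).neg
    rw [Finset.sum_range_zero, sub_zero] at h
    exact h.congr (ae_of_all _ fun ω => by simp [weightedSum])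
  refine ⟨R, hRm, isSubgaussian_of_hasSubgaussianMGF hRsub, hR, ?_, ?_,
    subgaussianStandard_le hRsub⟩
  · refine tendsto_of_tendsto_of_tendsto_of_le_of_le tendsto_const_nhds ?_ (fun _ => zero_le)
      fun n => subgaussianStandard_le (hsub n)
    simpa using ENNReal.tendsto_ofReal ((Real.continuous_sqrt.tendsto 0).comp hlim)
  · rw [ENNReal.tendsto_nhds_zero]
    intro ε hε
    obtain ⟨δ, hδ, hδε⟩ := ENNReal.lt_iff_exists_nnreal_btwn.1 hε
    have hδ0 : 0 < δ := ENNReal.coe_pos.1 hδ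
    -- Once the tail proxy is below `3/8 * δ²`, the Orlicz norm is at most `δ`.
    filter_upwards [hlim.eventually_le_const
      (show (0 : ℝ) < 3 / 8 * (δ : ℝ) ^ 2 by positivity)] with n hn
    refine (orliczNorm_youngPhi_le (hsub n) hδ0 ?_).trans hδε.le
    rw [Real.coe_toNNReal']
    exact max_le hn (by positivity)
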